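/- Let $k$ be an algebraically closed field of characteristic $0$ or $p>d$, where $d\ge 2$, and let $N\ge 0$. For an algebraically closed field $L$, $A\in\mathrm{SL}_N(L)$ and $\mathbf b\in L^N$, let $f_{A,\mathbf b}:\mathbb P^N_L\to\mathbb P^N_L$ be the extension to $\mathbb P^N$ of the map $\mathbf X\mapsto A\mathbf X^d+\mathbf b$ of $\mathbb A^N$, where $\mathbf X^d$ is the coordinatewise power. An endomorphism $f$ of $\mathbb P^N_L$ is called post-critically finite (PCF) if $P_f=\bigcup_{n\ge 1}f^n(C_f)$ is a proper Zariski closed subset of $\mathbb P^N$, where $C_f$ is the critical locus, defined by the vanishing of the determinant of the Jacobian of homogeneous forms representing $f$. Let $V$ be a variety over $k$ (an integral separated $k$-scheme of finite type) with function field $k(V)$. A family of such maps over $V$ is given by $A\in\mathrm{SL}_N(\Gamma(V,\mathcal O_V))$ and $\mathbf b\in\Gamma(V,\mathcal O_V)^N$. (1) There is no family over $V$ for which the generic member $f_{A,\mathbf b}$, regarded as a map over $\overline{k(V)}$, is PCF, such that $A$ is constant (i.e. comes from $\mathrm{SL}_N(k)$) but $\mathbf b$ is non-constant (i.e. does not come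 from $k^N$). (2) If $k$ is not an algebraic closure of a finite field, there is also no family over $V$ all of whose members $f_{A(t),\mathbf b(t)}$, $t\in V(k)$, are PCF, such that $A$ is constant but $\mathbf b$ is non-constant. -/

import Mathlib

open CategoryTheory AlgebraicGeometry

universe u

namespace PCF

/-- The projective space with homogeneous coordinates indexed by `ι` (dimension `#ι - 1`),
through its points over the field `K`. -/
abbrev PSpace (K ι : Type*) [Field K] := Projectivization K (ι → K)

/-- The common zeros in projective space of a set of forms. The polynomials used below are
homogeneous, so that the choice of the representative `P.rep` is irrelevant. -/
def zeroLocus {K ι : Type*} [Field K] (S : Set (MvPolynomial ι K)) : Set (PSpace K ι) :=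
  {P | ∀ G ∈ S, MvPolynomial.eval P.rep G = 0}

/-- Algebraic (that is, Zariski closed) subsets of projective space. -/
def IsAlgebraicSet {K ι : Type*} [Field K] (Z : Set (PSpace K ι)) : Prop :=
  ∃ S : Set (MvPolynomial ι K), (∀ G ∈ S, ∃ m : ℕ, G.IsHomogeneous m) ∧ Z = zeroLocus S

/-- A degree `d` endomorphism of projective space over an algebraically closed field, given by
forms of degree `d` without a common zero. -/
structure ProjEndo (K ι : Type*) [Field K] [IsAlgClosed K] (d : ℕ) where
  form : ι → MvPolynomial ι K
  homogeneous : ∀ i, (form i).IsHomogeneous d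
  noCommonZero : ∀ x : ι → K, (∀ i, MvPolynomial.eval x (form i) = 0) → x = 0

theorem eval_smul_of_isHomogeneous {K ι : Type*} [Field K] {d : ℕ} {F : MvPolynomial ι K}
    (hF : F.IsHomogeneous d) (t : K) (x : ι → K) :
    MvPolynomial.eval (t • x) F = t ^ d * MvPolynomial.eval x F := by
  rw [MvPolynomial.eval_eq, MvPolynomial.eval_eq, Finset.mul_sum]
  refine Finset.sum_congr rfl fun m hm => ?_
  have h := hF (MvPolynomial.mem_support_iff.mp hm)
  rw [Finsupp.weight_apply, Finsupp.sum] at h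
  simp only [Pi.smul_apply, smul_eq_mul, mul_pow, Finset.prod_mul_distrib,
    Finset.prod_pow_eq_pow_sum]
  simp only [Pi.one_apply, smul_eq_mul, mul_one] at h
  rw [h]
  ring

namespace ProjEndo

variable {K ι : Type*} [Field K] [IsAlgClosed K] {d : ℕ}

/-- The map on points `[x] ↦ [F(x)]`. -/
noncomputable def toFun (f : ProjEndo K ι d) : PSpace K ι → PSpace K ι :=
  Projectivization.lift
    (fun x => Projectivization.mk K (fun i => MvPolynomial.eval x.1 (f.form i))
      (fun h => x.2 (f.noCommonZero x.1 (fun i => congrFun h i))))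
    (by
      intro a b t hab
      rw [Projectivization.mk_eq_mk_iff']
      refine ⟨t ^ d, ?_⟩
      funext i
      rw [hab, eval_smul_of_isHomogeneous (f.homogeneous i)]
      rfl)

/-- The Jacobian matrix of the forms. -/
noncomputable def jacobian (f : ProjEndo K ι d) : Matrix ι ι (MvPolynomial ι K) :=
  Matrix.of fun i j => MvPolynomial.pderiv j (f.form i)

variable [Fintype ι] [DecidableEq ι]

/-- The critical locus: the vanishing of the determinant of the Jacobian. -/
noncomputable def criticalLocus (f : ProjEndo K ι d) : Set (PSpace K ι) :=
  zeroLocus {f.jacobian.det}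

/-- The post-critical locus `⋃_{n ≥ 1} fⁿ(C_f)`. -/
noncomputable def postCriticalLocus (f : ProjEndo K ι d) : Set (PSpace K ι) :=
  ⋃ n : ℕ, ⋃ _ : 1 ≤ n, f.toFun^[n] '' f.criticalLocus

/-- Post-critically finite: the post-critical locus is algebraic. Being a countable union of
hypersurfaces, it is then a proper subset (as a subset of the scheme it always misses the generic
point); as we work with points over a possibly countable field, properness is spelled out. -/
def IsPCF (f : ProjEndo K ι d) : Prop :=
  IsAlgebraicSet f.postCriticalLocus ∧ f.postCriticalLocus ≠ Set.univ

end ProjEndo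

/-- The matrix `(A b; 0 1)`. -/
def blockMatrix {R : Type*} [CommRing R] {N : ℕ} (A : Matrix.SpecialLinearGroup (Fin N) R)
    (b : Fin N → R) : Matrix (Fin N ⊕ Unit) (Fin N ⊕ Unit) R :=
  Matrix.fromBlocks A.1 (Matrix.of fun i _ => b i) 0 1

/-- The extension to projective `N`-space of the self-map `X ↦ A X^d + b` of affine `N`-space,
where `X^d` is the coordinatewise power: the `i`-th form is `∑ j, L i j * X j ^ d`, for
`L = (A b; 0 1)`. The coordinate at `Sum.inr ()` is the homogenizing one. -/
noncomputable def unicritical {K : Type*} [Field K] [IsAlgClosed K] {N d : ℕ} (hd : 2 ≤ d)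
    (A : Matrix.SpecialLinearGroup (Fin N) K) (b : Fin N → K) :
    ProjEndo K (Fin N ⊕ Unit) d where
  form i := ∑ j, MvPolynomial.C (blockMatrix A b i j) * MvPolynomial.X j ^ d
  homogeneous i := by
    refine MvPolynomial.IsHomogeneous.sum _ _ _ fun j _ => ?_
    simpa using ((MvPolynomial.isHomogeneous_X K j).pow d).C_mul (blockMatrix A b i j)
  noCommonZero x hx := by
    have h1 : (blockMatrix A b).mulVec (fun j => x j ^ d) = 0 := by
      funext i
      simpa [Matrix.mulVec, dotProduct] using hx i
    have h2 : (blockMatrix A b).det ≠ 0 := by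
      simp [blockMatrix]
    have h3 := Matrix.eq_zero_of_mulVec_eq_zero h2 h1
    funext j
    exact (pow_eq_zero_iff (by omega)).mp (congrFun h3 j)

/-- The constants: the ring map from `k` to the regular functions on a `k`-scheme `V`. -/
noncomputable def const {k : Type u} [Field k] {V : Scheme.{u}} (π : V ⟶ Spec (.of k)) :
    k →+* Γ(V, ⊤) :=
  ((Scheme.ΓSpecIso (.of k)).inv ≫ π.appTop).hom

/-- The coefficients of an algebraic family of maps `X ↦ A X^d + b` over `V`: a morphism from `V`
to `SL_N × 𝔸^N`, given by regular functions on `V`. -/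
structure Family (V : Scheme.{u}) (N : ℕ) where
  A : Matrix.SpecialLinearGroup (Fin N) Γ(V, ⊤)
  b : Fin N → Γ(V, ⊤)

namespace Family

variable {V : Scheme.{u}} {N : ℕ}

/-- The member of the family obtained by mapping its coefficients to a field. -/
noncomputable def specialize (f : Family V N) {d : ℕ} (hd : 2 ≤ d) {L : Type u} [Field L]
    [IsAlgClosed L] (φ : Γ(V, ⊤) →+* L) : ProjEndo L (Fin N ⊕ Unit) d :=
  unicritical hd (Matrix.SpecialLinearGroup.map φ f.A) (fun i => φ (f.b i))

/-- The family, seen as a single map with coefficients in the function field of `V` (embedded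
in its algebraic closure). -/
noncomputable def genericMember (f : Family V N) [IsIntegral V] {d : ℕ} (hd : 2 ≤ d) :
    ProjEndo (AlgebraicClosure V.functionField) (Fin N ⊕ Unit) d :=
  f.specialize hd
    ((algebraMap V.functionField (AlgebraicClosure V.functionField)).comp
      (V.presheaf.germ ⊤ (genericPoint V) trivial).hom)

/-- The member of the family at a point of `V` with values in an algebraically closed field. -/
noncomputable def member (f : Family V N) {d : ℕ} (hd : 2 ≤ d) {L : Type u} [Field L]
    [IsAlgClosed L] (t : Spec (.of L) ⟶ V) : ProjEndo L (Fin N ⊕ Unit) d :=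
  f.specialize hd (t.appTop ≫ (Scheme.ΓSpecIso (.of L)).hom).hom

/-- The matrix `A` of the family is constant. -/
def ConstantA {k : Type u} [Field k] (π : V ⟶ Spec (.of k)) (f : Family V N) : Prop :=
  ∃ A₀ : Matrix.SpecialLinearGroup (Fin N) k,
    f.A = Matrix.SpecialLinearGroup.map (const π) A₀

/-- The vector `b` of the family is constant. -/
def ConstantB {k : Type u} [Field k] (π : V ⟶ Spec (.of k)) (f : Family V N) : Prop :=
  ∃ b₀ : Fin N → k, ∀ i, f.b i = const π (b₀ i)

end Family

end PCF

/-! Fix a valuation ring `O` of an algebraically closed field containing the entries of `A` but not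
all entries of `b`. Since `det A = 1`, the inverse of `A` is also integral, so `A` preserves the sup
norm, and once a point has norm at least `B = |b| > 1` each iterate raises its norm to the power
`d`. Choose `j` with `|(A⁻¹ b)_j| = B`. Every affine point of the critical hyperplane `x_j = 0` is
mapped to norm at least `B`, because the `j`-th coordinate of `A⁻¹ f(x)` is that of `A⁻¹ b`. The
origin lies on this hyperplane and is mapped to `b`, of norm exactly `B`.

If `f` is PCF, the images `fⁿ(x_j = 0)`, `n ≥ 1`, are irreducible hypersurfaces inside one proper
hypersurface, so two of them coincide: the `m`-th image of the origin is the `n`-th image of some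
`x` on the hyperplane, with `m < n` (`exists_iterate_eq_of_isPCF`). The norms are `B ^ d ^ (m - 1)`
and at least `B ^ d ^ (n - 1)`, a contradiction (`not_isPCF_of_notMem_valuationSubring`).

It remains to find `O`. For (1), a non-constant `b i` is not integral over `k`, so some valuation
ring containing `k` omits it. For (2), `k` is not integral over the ring generated by the entries of
`A`; as `b i` takes almost every value in `k`, it takes a non-integral one at some point, and a
valuation ring of `k` omits that value. -/

namespace PCF

/-! ### Integral extensions, valuation rings and values of regular functions -/

section CommutativeAlgebra

/-- In an integral extension of a normal domain by a factorial one, the contraction of a principal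
prime is minimal over every nonzero principal ideal it contains. -/
theorem comap_span_singleton_mem_minimalPrimes {R S : Type*} [CommRing R] [IsDomain R]
    [IsIntegrallyClosed R] [CommRing S] [IsDomain S] [UniqueFactorizationMonoid S]
    {φ : R →+* S} (hφ : φ.IsIntegral) (hinj : Function.Injective φ) {x : S} (hx : Prime x)
    {G : R} (hG : G ≠ 0) (hGx : φ G ∈ Ideal.span {x}) :
    (Ideal.span {x}).comap φ ∈ (Ideal.span {G}).minimalPrimes := by
  algebraize [φ]
  have : FaithfulSMul R S := (faithfulSMul_iff_algebraMap_injective R S).mpr hinj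
  have hprime : (Ideal.span {x}).IsPrime := (Ideal.span_singleton_prime hx.ne_zero).mpr hx
  obtain ⟨q, hq, hqP⟩ := Ideal.exists_minimalPrimes_le
    (I := Ideal.span {G}) (J := (Ideal.span {x}).comap φ)
    ((Ideal.span_singleton_le_iff_mem _).mpr hGx)
  have := hq.isPrime
  rcases hqP.lt_or_eq with hlt | rfl
  -- Going-down would give a nonzero prime `Q` strictly below `(x)`. In a factorial ring `Q`
  -- contains a prime element; `x` divides it, hence is associated to it, so `x ∈ Q`.
  · exfalso
    have : (Ideal.span {x}).LiesOver ((Ideal.span {x}).comap φ) := ⟨rfl⟩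
    obtain ⟨Q, hQ, hQp, hQq⟩ := Ideal.exists_ideal_lt_liesOver_of_lt (Ideal.span {x}) hlt
    have hφG : φ G ∈ Q := by
      have : G ∈ q := hq.1.2 (Ideal.mem_span_singleton_self G)
      rw [hQq.over] at this
      exact this
    have hbot : Q ≠ ⊥ := by
      rintro rfl
      exact hG (hinj (by simpa using hφG))
    obtain ⟨y, hyQ, hy⟩ := hQp.exists_mem_prime_of_ne_bot hbot
    have hxy : x ∣ y := Ideal.mem_span_singleton.mp (hQ.le hyQ)
    refine hQ.not_ge ((Ideal.span_singleton_le_iff_mem _).mpr ?_)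
    exact Q.mem_of_dvd ((hx.irreducible.associated_of_dvd hy.irreducible hxy).symm.dvd) hyQ
  · exact hq

/-- Lying over for maximal ideals containing a given ideal. -/
theorem exists_isMaximal_comap_eq {R S : Type*} [CommRing R] [CommRing S] {φ : R →+* S}
    (hφ : φ.IsIntegral) {M : Ideal R} (hM : M.IsMaximal) {I : Ideal S} (hI : I.comap φ ≤ M) :
    ∃ Q : Ideal S, Q.IsMaximal ∧ I ≤ Q ∧ Q.comap φ = M := by
  algebraize [φ]
  obtain ⟨Q, hIQ, hQ, hQM⟩ := Ideal.exists_ideal_over_prime_of_isIntegral M I hI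
  exact ⟨Q, Ideal.isMaximal_of_isIntegral_of_isMaximal_comap Q (by rwa [hQM]), hIQ, hQM⟩

/-- Lying over, for maps between affine spaces: a point at which the contraction of `I` vanishes
is the image of a point at which `I` vanishes. -/
theorem exists_eval_eq_of_isIntegral {K σ : Type*} [Field K] [IsAlgClosed K] [Finite σ]
    {φ : MvPolynomial σ K →+* MvPolynomial σ K} (hφ : φ.IsIntegral)
    {I : Ideal (MvPolynomial σ K)} {y : σ → K}
    (hy : ∀ p, φ p ∈ I → MvPolynomial.eval y p = 0) :
    ∃ x : σ → K, (∀ p ∈ I, MvPolynomial.eval x p = 0) ∧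
      ∀ p, MvPolynomial.eval y p = 0 → MvPolynomial.eval x (φ p) = 0 := by
  have key (z : σ → K) (p : MvPolynomial σ K) :
      p ∈ (MvPolynomial.vanishingIdeal K {z} : Ideal (MvPolynomial σ K)) ↔
        MvPolynomial.eval z p = 0 := by
    rw [MvPolynomial.mem_vanishingIdeal_singleton_iff, MvPolynomial.aeval_eq_eval]
  obtain ⟨Q, hQ, hIQ, hQM⟩ := exists_isMaximal_comap_eq hφ
    (M := MvPolynomial.vanishingIdeal K {y}) (I := I) inferInstance
    (fun p hp => (key y p).mpr (hy p hp))
  obtain ⟨x, rfl⟩ := MvPolynomial.isMaximal_iff_eq_vanishingIdeal_singleton.mp hQ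
  refine ⟨x, fun p hp => (key x p).mp (hIQ hp), fun p hp => (key x _).mp ?_⟩
  rw [← Ideal.mem_comap, hQM]
  exact (key y p).mpr hp

/-- The integral closure of `R` in `K` is the intersection of the valuation rings of `K` containing
the image of `R`. -/
theorem exists_valuationSubring_of_not_isIntegral {R K : Type*} [CommRing R] [Field K]
    [Algebra R K] {x : K} (hx : ¬ IsIntegral R x) :
    ∃ V : ValuationSubring K, (∀ r, algebraMap R K r ∈ V) ∧ x ∉ V := by
  have hcl : IsIntegrallyClosedIn (integralClosure R K).toSubring K :=
    inferInstanceAs (IsIntegrallyClosedIn (integralClosure R K) K)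
  obtain ⟨V, hV, hxV⟩ := Subring.exists_le_valuationSubring_of_isIntegrallyClosedIn
    (R := (integralClosure R K).toSubring) (x := x) hx
  exact ⟨V, fun r => hV ((integralClosure R K).algebraMap_mem r), hxV⟩

theorem exists_algebraMap_eq_of_isIntegral {k D : Type*} [Field k] [IsAlgClosed k] [CommRing D]
    [IsDomain D] [Algebra k D] {x : D} (hx : IsIntegral k x) : ∃ c, algebraMap k D c = x := by
  obtain ⟨c, hc⟩ := (IsAlgClosed.algebraMap_bijective_of_isIntegral
    (k := k) (K := integralClosure k D)).2 ⟨x, hx⟩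
  exact ⟨c, congrArg Subtype.val hc⟩

theorem isJacobsonRing_int : IsJacobsonRing ℤ := by
  refine isJacobsonRing_iff_prime_eq.mpr fun P hP => ?_
  rcases eq_or_ne P ⊥ with rfl | hne
  · refine le_antisymm (fun n hn => ?_) Ideal.le_jacobson
    -- Membership in the radical makes `n * n + 1` a unit, hence `±1`.
    have h := Ideal.mem_jacobson_bot.mp hn n
    rcases Int.isUnit_iff.mp h with h | h
    · have : n = 0 := by nlinarith
      simp [this]
    · nlinarith
  · have := hP.isMaximal hne
    exact Ideal.jacobson_eq_self_of_isMaximal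

/-- A field that is not algebraic over a finite field is not integral over any of its finitely
generated subrings. -/
theorem exists_not_isIntegral_adjoin {k : Type*} [Field k]
    (hk : ∀ (p : ℕ) [Fact p.Prime] [Algebra (ZMod p) k], ¬ Algebra.IsAlgebraic (ZMod p) k)
    {s : Set k} (hs : s.Finite) : ∃ x : k, ¬ IsIntegral (Algebra.adjoin ℤ s) x := by
  -- Otherwise the subring is itself a field, finitely generated over the Jacobson ring `ℤ`, hence
  -- finite over `ℤ`, so `k` is integral over `ℤ`.
  by_contra! hall
  have hint : Algebra.IsIntegral (Algebra.adjoin ℤ s) k := ⟨hall⟩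
  have hR : IsField (Algebra.adjoin ℤ s) := isField_of_isIntegral_of_isField
    (FaithfulSMul.algebraMap_injective (Algebra.adjoin ℤ s) k) (Field.toIsField k)
  have hft : Algebra.FiniteType ℤ (Algebra.adjoin ℤ s) :=
    (Subalgebra.fg_iff_finiteType _).mp ⟨hs.toFinset, by simp⟩
  have hfin : Module.Finite ℤ (Algebra.adjoin ℤ s) := by
    have := isJacobsonRing_int
    let _ := hR.toField
    exact finite_of_finite_type_of_isJacobsonRing ℤ (Algebra.adjoin ℤ s)
  have hZ : Algebra.IsIntegral ℤ k := Algebra.IsIntegral.trans (Algebra.adjoin ℤ s)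
  obtain ⟨p, hp⟩ := CharP.exists k
  rcases CharP.char_is_prime_or_zero k p with hprime | rfl
  · have := Fact.mk hprime
    let _ := ZMod.algebra k p
    exact hk p ⟨fun x => ((hZ.isIntegral x).tower_top (A := ZMod p)).isAlgebraic⟩
  · have := CharP.charP_to_charZero k
    exact Int.not_isField (isField_of_isIntegral_of_isField
      (FaithfulSMul.algebraMap_injective ℤ k) (Field.toIsField k))

/-- Translating the integral closure by a non-integral `x` lands in the non-integral elements; if
these were finite, so would be `k`. -/
theorem infinite_setOf_not_isIntegral {R k : Type*} [CommRing R] [Field k] [Infinite k]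
    [Algebra R k] (h : ∃ x : k, ¬ IsIntegral R x) : {x : k | ¬ IsIntegral R x}.Infinite := by
  obtain ⟨x, hx⟩ := h
  intro hfin
  have h1 : ((integralClosure R k : Set k)).Finite := by
    refine (hfin.preimage (f := fun y => x + y) (add_right_injective x).injOn).subset ?_
    intro y hy hxy
    exact hx (by simpa using hxy.sub hy)
  refine Set.infinite_univ (α := k) ((hfin.union h1).subset fun y _ => ?_)
  exact (em (IsIntegral R y)).symm

/-- A transcendental element of a finitely generated domain over an algebraically closed field
takes all but finitely many values at the points. -/
theorem exists_algHom_apply_eq {k S : Type*} [Field k] [IsAlgClosed k] [CommRing S] [IsDomain S]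
    [Algebra k S] [Algebra.FiniteType k S] {s : S} (hs : Transcendental k s) :
    ∃ h : Polynomial k, h ≠ 0 ∧ ∀ β : k, h.eval β ≠ 0 → ∃ σ : S →ₐ[k] k, σ s = β := by
  algebraize [(Polynomial.aeval (R := k) s).toRingHom]
  have : IsScalarTower k (Polynomial k) S :=
    IsScalarTower.of_algebraMap_eq fun c => by
      simp [RingHom.algebraMap_toAlgebra]
  have hinj : Function.Injective (algebraMap (Polynomial k) S) :=
    transcendental_iff_injective.mp hs
  have : FaithfulSMul (Polynomial k) S := (faithfulSMul_iff_algebraMap_injective _ _).mpr hinj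
  have : Algebra.FiniteType (Polynomial k) S :=
    Algebra.FiniteType.of_restrictScalars_finiteType k (Polynomial k) S
  have : Algebra.FinitePresentation (Polynomial k) S :=
    Algebra.FinitePresentation.of_finiteType.mp inferInstance
  -- Torsion-free over a Dedekind domain is flat, so `Spec S → 𝔸¹` is open; its image contains the
  -- generic point, hence a basic open set `D(h)`.
  have : Module.Flat (Polynomial k) S :=
    IsDedekindDomain.flat_iff_torsion_eq_bot.mpr
      (Submodule.isTorsionFree_iff_torsion_eq_bot.mp inferInstance)
  have hopen := (PrimeSpectrum.isOpenMap_comap_of_hasGoingDown_of_finitePresentation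
    (R := Polynomial k) (S := S)).isOpen_range
  have hbot : (⟨⊥, Ideal.isPrime_bot⟩ : PrimeSpectrum (Polynomial k)) ∈
      Set.range (PrimeSpectrum.comap (algebraMap (Polynomial k) S)) := by
    refine ⟨⟨⊥, Ideal.isPrime_bot⟩, PrimeSpectrum.ext ?_⟩
    simp [← RingHom.ker_eq_comap_bot]
  obtain ⟨_, ⟨_, ⟨h, rfl⟩, rfl⟩, hh, hsub⟩ :=
    PrimeSpectrum.isBasis_basic_opens.exists_subset_of_mem_open hbot hopen
  refine ⟨h, fun h0 => hh (by simp [h0]), fun β hβ => ?_⟩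
  have hprime : (Ideal.span {Polynomial.X - Polynomial.C β}).IsPrime :=
    (Ideal.span_singleton_prime (Polynomial.X_sub_C_ne_zero β)).mpr (Polynomial.prime_X_sub_C β)
  obtain ⟨q, hq⟩ := hsub (a := ⟨_, hprime⟩) (fun hmem => hβ (by
    rw [Ideal.mem_span_singleton, Polynomial.dvd_iff_isRoot] at hmem
    exact hmem))
  obtain ⟨M, hM, hqM⟩ := q.asIdeal.exists_le_maximal q.2.ne_top
  have hsβ : s - algebraMap k S β ∈ M := by
    have h1 : Polynomial.X - Polynomial.C β ∈
        (PrimeSpectrum.comap (algebraMap (Polynomial k) S) q).asIdeal := by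
      rw [hq]
      exact Ideal.mem_span_singleton_self _
    have h2 := hqM h1
    simpa [RingHom.algebraMap_toAlgebra] using h2
  let _ : Field (S ⧸ M) := Ideal.Quotient.field M
  have : Module.Finite k (S ⧸ M) := finite_of_finite_type_of_isJacobsonRing k (S ⧸ M)
  let e : k ≃ₐ[k] (S ⧸ M) := AlgEquiv.ofBijective (Algebra.ofId k (S ⧸ M))
    IsAlgClosed.algebraMap_bijective_of_isIntegral
  refine ⟨e.symm.toAlgHom.comp (Ideal.Quotient.mkₐ k M), ?_⟩
  have h3 : Ideal.Quotient.mkₐ k M s = algebraMap k (S ⧸ M) β := by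
    rw [IsScalarTower.algebraMap_apply k S (S ⧸ M)]
    exact Ideal.Quotient.eq.mpr hsβ
  simp only [AlgHom.comp_apply, h3]
  exact e.symm.commutes β

end CommutativeAlgebra

/-! ### Lifting iteration to the affine cone -/

section Evaluation

namespace ProjEndo

variable {K ι : Type*} [Field K] [IsAlgClosed K] {d : ℕ}

/-- The lift of an endomorphism of projective space to affine coordinates. -/
noncomputable def coordMap (f : ProjEndo K ι d) (x : ι → K) : ι → K :=
  fun i => MvPolynomial.eval x (f.form i)

theorem coordMap_ne_zero (f : ProjEndo K ι d) {x : ι → K} (hx : x ≠ 0) : f.coordMap x ≠ 0 :=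
  fun h => hx (f.noCommonZero x fun i => congrFun h i)

theorem iterate_coordMap_ne_zero (f : ProjEndo K ι d) {x : ι → K} (hx : x ≠ 0) (n : ℕ) :
    f.coordMap^[n] x ≠ 0 := by
  induction n with
  | zero => exact hx
  | succ n ih => rw [Function.iterate_succ_apply']; exact f.coordMap_ne_zero ih

theorem iterate_toFun_mk (f : ProjEndo K ι d) {x : ι → K} (hx : x ≠ 0) (n : ℕ) :
    f.toFun^[n] (Projectivization.mk K x hx) =
      Projectivization.mk K (f.coordMap^[n] x) (f.iterate_coordMap_ne_zero hx n) := by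
  induction n with
  | zero => rfl
  | succ n ih =>
    rw [Function.iterate_succ_apply', ih]
    simp only [Function.iterate_succ_apply']
    rfl

/-- Substitution of the forms into a polynomial. -/
noncomputable def pullback (f : ProjEndo K ι d) : MvPolynomial ι K →+* MvPolynomial ι K :=
  (MvPolynomial.aeval f.form).toRingHom

theorem eval_pullback (f : ProjEndo K ι d) (x : ι → K) (p : MvPolynomial ι K) :
    MvPolynomial.eval x (f.pullback p) = MvPolynomial.eval (f.coordMap x) p := by
  have h : (MvPolynomial.eval x).comp f.pullback = MvPolynomial.eval (f.coordMap x) := by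
    ext i
    · simp [pullback]
    · simp [pullback, coordMap]
  exact congrArg (fun φ : MvPolynomial ι K →+* K => φ p) h

theorem eval_pullback_pow (f : ProjEndo K ι d) (n : ℕ) (x : ι → K) (p : MvPolynomial ι K) :
    MvPolynomial.eval x ((f.pullback ^ n) p) = MvPolynomial.eval (f.coordMap^[n] x) p := by
  induction n generalizing x with
  | zero => rfl
  | succ n ih =>
    rw [pow_succ', RingHom.mul_def, RingHom.comp_apply, eval_pullback, ih,
      Function.iterate_succ_apply]

end ProjEndo

theorem eval_rep_mk_eq_zero_iff {K ι : Type*} [Field K] {m : ℕ} {G : MvPolynomial ι K}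
    (hG : G.IsHomogeneous m) {x : ι → K} (hx : x ≠ 0) :
    MvPolynomial.eval (Projectivization.mk K x hx).rep G = 0 ↔ MvPolynomial.eval x G = 0 := by
  obtain ⟨a, ha⟩ := Projectivization.exists_smul_eq_mk_rep K x hx
  rw [← ha, Units.smul_def, eval_smul_of_isHomogeneous hG]
  simp

theorem rep_mk_apply_eq_zero_iff {K ι : Type*} [Field K] {x : ι → K} (hx : x ≠ 0) (j : ι) :
    (Projectivization.mk K x hx).rep j = 0 ↔ x j = 0 := by
  simpa using eval_rep_mk_eq_zero_iff (MvPolynomial.isHomogeneous_X K j) hx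

end Evaluation

/-! ### Images of critical hyperplanes under a PCF map -/

section Unicritical

theorem isUnit_det_blockMatrix {K : Type*} [Field K] {N : ℕ}
    (A : Matrix.SpecialLinearGroup (Fin N) K) (b : Fin N → K) : IsUnit (blockMatrix A b).det := by
  simp [blockMatrix]

variable {K : Type*} [Field K] [IsAlgClosed K] {N d : ℕ} (hd : 2 ≤ d)
  (A : Matrix.SpecialLinearGroup (Fin N) K) (b : Fin N → K)

theorem coordMap_unicritical (x : Fin N ⊕ Unit → K) :
    (unicritical hd A b).coordMap x = (blockMatrix A b).mulVec (fun j => x j ^ d) := by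
  funext i
  simp [ProjEndo.coordMap, unicritical, Matrix.mulVec, dotProduct]

theorem coordMap_unicritical_inl (x : Fin N ⊕ Unit → K) (i : Fin N) :
    (unicritical hd A b).coordMap x (.inl i) =
      A.1.mulVec (fun j => x (.inl j) ^ d) i + b i * x (.inr ()) ^ d := by
  simp [coordMap_unicritical, blockMatrix, Matrix.mulVec, dotProduct]

theorem coordMap_unicritical_inr (x : Fin N ⊕ Unit → K) :
    (unicritical hd A b).coordMap x (.inr ()) = x (.inr ()) ^ d := by
  simp [coordMap_unicritical, blockMatrix, Matrix.mulVec, dotProduct]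

theorem iterate_coordMap_unicritical_inr (x : Fin N ⊕ Unit → K) (n : ℕ) :
    (unicritical hd A b).coordMap^[n] x (.inr ()) = x (.inr ()) ^ d ^ n := by
  induction n with
  | zero => simp
  | succ n ih =>
    rw [Function.iterate_succ_apply', coordMap_unicritical_inr, ih, ← pow_mul, pow_succ]

theorem coordMap_unicritical_surjective :
    Function.Surjective (unicritical hd A b).coordMap := by
  intro y
  choose r hr using fun j =>
    IsAlgClosed.exists_pow_nat_eq (((blockMatrix A b)⁻¹).mulVec y j) (by omega : 0 < d)
  refine ⟨r, ?_⟩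
  rw [coordMap_unicritical, funext hr, Matrix.mulVec_mulVec,
    Matrix.mul_nonsing_inv _ (isUnit_det_blockMatrix A b), Matrix.one_mulVec]

theorem pullback_unicritical_injective :
    Function.Injective (unicritical hd A b).pullback := by
  rw [injective_iff_map_eq_zero]
  intro p hp
  refine MvPolynomial.funext fun y => ?_
  obtain ⟨x, rfl⟩ := coordMap_unicritical_surjective hd A b y
  rw [← ProjEndo.eval_pullback, hp, map_zero, map_zero]

/-- Inverting the block matrix exhibits each `X j ^ d` as the image of a linear form. -/
theorem pullback_unicritical_isIntegral : (unicritical hd A b).pullback.IsIntegral := by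
  set φ := (unicritical hd A b).pullback with hφ
  have hC (c : K) : φ (MvPolynomial.C c) = MvPolynomial.C c := by
    simp [hφ, ProjEndo.pullback, MvPolynomial.algebraMap_eq]
  have hX (j : Fin N ⊕ Unit) : φ (∑ i, MvPolynomial.C ((blockMatrix A b)⁻¹ j i) *
      MvPolynomial.X i) = MvPolynomial.X j ^ d := by
    refine MvPolynomial.funext fun x => ?_
    rw [hφ, ProjEndo.eval_pullback, coordMap_unicritical]
    have h := congrFun (Matrix.mulVec_mulVec (fun j => x j ^ d) (blockMatrix A b)⁻¹
      (blockMatrix A b)) j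
    rw [Matrix.nonsing_inv_mul _ (isUnit_det_blockMatrix A b), Matrix.one_mulVec] at h
    simpa [Matrix.mulVec, dotProduct] using h
  intro p
  induction p using MvPolynomial.induction_on with
  | C c => rw [← hC c]; exact φ.isIntegralElem_map
  | add p q hp hq => exact hp.add φ hq
  | mul_X p j hp =>
    refine hp.mul φ ⟨_, Polynomial.monic_X_pow_sub_C (∑ i, MvPolynomial.C
      ((blockMatrix A b)⁻¹ j i) * MvPolynomial.X i) (by omega : d ≠ 0), ?_⟩
    rw [Polynomial.eval₂_sub, Polynomial.eval₂_X_pow, Polynomial.eval₂_C, hX, sub_self]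

theorem pullback_unicritical_pow_isIntegral (n : ℕ) :
    ((unicritical hd A b).pullback ^ n).IsIntegral := by
  induction n with
  | zero => exact RingHom.isIntegral_of_surjective _ Function.surjective_id
  | succ n ih =>
    rw [pow_succ']
    exact ih.trans _ _ (pullback_unicritical_isIntegral hd A b)

theorem pullback_unicritical_pow_injective (n : ℕ) :
    Function.Injective ((unicritical hd A b).pullback ^ n) := by
  rw [RingHom.coe_pow]
  exact (pullback_unicritical_injective hd A b).iterate n

theorem mk_mem_criticalLocus_unicritical {x : Fin N ⊕ Unit → K} (hx : x ≠ 0)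
    {j : Fin N ⊕ Unit} (hj : x j = 0) :
    Projectivization.mk K x hx ∈ (unicritical hd A b).criticalLocus := by
  rintro _ rfl
  rw [RingHom.map_det]
  refine Matrix.det_eq_zero_of_column_eq_zero j fun i => ?_
  have hj' := (rep_mk_apply_eq_zero_iff hx j).mpr hj
  have hd' : d - 1 ≠ 0 := by omega
  simp only [RingHom.mapMatrix_apply, Matrix.map_apply, ProjEndo.jacobian, unicritical,
    Matrix.of_apply, map_sum, MvPolynomial.pderiv_C_mul]
  refine Finset.sum_eq_zero fun l _ => ?_
  rcases eq_or_ne l j with rfl | hl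
  · simp [Derivation.leibniz_pow, hj', hd']
  · simp [MvPolynomial.pderiv_X_of_ne hl, Derivation.leibniz_pow]

/-- If a unicritical map is post-critically finite, then on every affine coordinate hyperplane
there is a point whose `n`-th image is the `m`-th image of the origin, for some `1 ≤ m < n`. -/
theorem exists_iterate_eq_of_isPCF (h : (unicritical hd A b).IsPCF) (j : Fin N) :
    ∃ m n : ℕ, 1 ≤ m ∧ m < n ∧ ∃ x : Fin N ⊕ Unit → K, x (.inl j) = 0 ∧
      (unicritical hd A b).coordMap^[n] x =
        (unicritical hd A b).coordMap^[m] (Pi.single (.inr ()) 1) := by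
  classical
  set f := unicritical hd A b with hf
  obtain ⟨⟨S, hS, hZ⟩, huniv⟩ := h
  obtain ⟨P, hP⟩ := (Set.ne_univ_iff_exists_notMem _).mp huniv
  rw [hZ] at hP
  simp only [zeroLocus, Set.mem_ofPred_eq, not_forall] at hP
  obtain ⟨G, hGS, hGP⟩ := hP
  have hG0 : G ≠ 0 := fun h0 => hGP (by simp [h0])
  obtain ⟨r, hr⟩ := hS G hGS
  have hvanish (n : ℕ) (hn : 1 ≤ n) (x : Fin N ⊕ Unit → K) (hx : x ≠ 0) (hxj : x (.inl j) = 0) :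
      MvPolynomial.eval x ((f.pullback ^ n) G) = 0 := by
    rw [f.eval_pullback_pow, ← eval_rep_mk_eq_zero_iff hr (f.iterate_coordMap_ne_zero hx n),
      ← f.iterate_toFun_mk hx]
    have hmem : f.toFun^[n] (Projectivization.mk K x hx) ∈ f.postCriticalLocus :=
      Set.mem_iUnion₂.mpr ⟨n, hn, _, mk_mem_criticalLocus_unicritical hd A b hx hxj, rfl⟩
    rw [hZ] at hmem
    exact hmem G hGS
  have hprime : Prime (MvPolynomial.X (.inl j) : MvPolynomial (Fin N ⊕ Unit) K) :=
    MvPolynomial.X_prime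
  have hidl : (Ideal.span {(MvPolynomial.X (.inl j) : MvPolynomial (Fin N ⊕ Unit) K)}).IsPrime :=
    (Ideal.span_singleton_prime hprime.ne_zero).mpr hprime
  have hmem (n : ℕ) (hn : 1 ≤ n) : (f.pullback ^ n) G ∈
      Ideal.span {(MvPolynomial.X (.inl j) : MvPolynomial (Fin N ⊕ Unit) K)} := by
    -- The factor `X (.inr ())` takes care of the vertex of the cone, which is not a projective
    -- point; it is removed by primality.
    have h1 : MvPolynomial.X (.inr ()) * (f.pullback ^ n) G ∈
        Ideal.span {(MvPolynomial.X (.inl j) : MvPolynomial (Fin N ⊕ Unit) K)} := by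
      rw [← MvPolynomial.IsPrime.vanishingIdeal_zeroLocus (K := K)
        (Ideal.span {(MvPolynomial.X (.inl j) : MvPolynomial (Fin N ⊕ Unit) K)}),
        MvPolynomial.mem_vanishingIdeal_iff]
      intro x hx
      have hxj : x (.inl j) = 0 := by
        simpa using hx _ (Ideal.mem_span_singleton_self _)
      rcases eq_or_ne x 0 with rfl | hx0
      · simp
      · have := hvanish n hn x hx0 hxj
        rw [MvPolynomial.aeval_eq_eval, map_mul, this, mul_zero]
    refine (hidl.mem_or_mem h1).resolve_left fun h2 => ?_
    rw [Ideal.mem_span_singleton, MvPolynomial.X_dvd_X] at h2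
    simp at h2
  -- The prime ideal of the `(n + 1)`-st image of the hyperplane; the post-critical locus starts
  -- with the first image.
  let P' (n : ℕ) : Ideal (MvPolynomial (Fin N ⊕ Unit) K) :=
    (Ideal.span {(MvPolynomial.X (.inl j) : MvPolynomial (Fin N ⊕ Unit) K)}).comap
      (f.pullback ^ (n + 1))
  have hmin (n : ℕ) : P' n ∈ (Ideal.span {G}).minimalPrimes :=
    comap_span_singleton_mem_minimalPrimes (pullback_unicritical_pow_isIntegral hd A b _)
      (pullback_unicritical_pow_injective hd A b _) hprime hG0 (hmem _ (by omega))
  obtain ⟨m, n, hmn, heq⟩ : ∃ m n, m < n ∧ P' m = P' n := by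
    have hfin := (Ideal.span {G}).finite_minimalPrimes_of_isNoetherianRing
    have : Finite (Ideal.span {G}).minimalPrimes := hfin.to_subtype
    obtain ⟨m, n, hne, heq⟩ := Finite.exists_ne_map_eq_of_infinite
      (fun n => (⟨P' n, hmin n⟩ : (Ideal.span {G}).minimalPrimes))
    have heq' : P' m = P' n := congrArg Subtype.val heq
    rcases hne.lt_or_gt with hlt | hlt
    · exact ⟨m, n, hlt, heq'⟩
    · exact ⟨n, m, hlt, heq'.symm⟩
  -- The origin is on the hyperplane, so its `(m + 1)`-st image is a zero of `P' m = P' n`; lying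
  -- over makes it an `(n + 1)`-st image.
  obtain ⟨x, hx, hxy⟩ := exists_eval_eq_of_isIntegral
    (pullback_unicritical_pow_isIntegral hd A b (n + 1))
    (I := Ideal.span {(MvPolynomial.X (.inl j) : MvPolynomial (Fin N ⊕ Unit) K)})
    (y := f.coordMap^[m + 1] (Pi.single (.inr ()) 1)) (fun p hp => by
      have hp' : p ∈ P' m := by rw [heq]; exact hp
      obtain ⟨q, hq⟩ := Ideal.mem_span_singleton.mp (Ideal.mem_comap.mp hp')
      rw [← f.eval_pullback_pow, hq]
      simp)
  refine ⟨m + 1, n + 1, by omega, by omega, x, ?_, ?_⟩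
  · simpa using hx _ (Ideal.mem_span_singleton_self _)
  · funext i
    have h1 := hxy (MvPolynomial.X i -
      MvPolynomial.C (f.coordMap^[m + 1] (Pi.single (.inr ()) 1) i)) (by simp)
    rw [← hf, f.eval_pullback_pow] at h1
    simpa [sub_eq_zero] using h1

end Unicritical

/-! ### Escape to infinity at a place where `b` has a pole -/

section Valuation

variable {K Γ₀ : Type*} [Field K] [LinearOrderedCommGroupWithZero Γ₀] (v : Valuation K Γ₀)

/-- The supremum norm of a vector with respect to a valuation. -/
def supNorm {ι : Type*} [Fintype ι] (y : ι → K) : Γ₀ :=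
  Finset.univ.sup fun i => v (y i)

section

variable {ι : Type*} [Fintype ι]

theorem le_supNorm (y : ι → K) (i : ι) : v (y i) ≤ supNorm v y :=
  Finset.le_sup (f := fun i => v (y i)) (Finset.mem_univ i)

theorem supNorm_le_iff {y : ι → K} {B : Γ₀} : supNorm v y ≤ B ↔ ∀ i, v (y i) ≤ B := by
  simp [supNorm, Finset.sup_le_iff]

/-- The hypothesis also excludes an empty index type, where the supremum is `0`. -/
theorem exists_eq_supNorm {y : ι → K} (h : supNorm v y ≠ 0) : ∃ i, v (y i) = supNorm v y := by
  by_contra! hne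
  have hlt : supNorm v y < supNorm v y :=
    (Finset.sup_lt_iff (bot_le.trans_lt (zero_lt_iff.mpr h))).mpr
      fun i _ => (le_supNorm v y i).lt_of_ne (hne i)
  exact hlt.false

theorem supNorm_mulVec_le {M : Matrix ι ι K} (hM : ∀ i j, v (M i j) ≤ 1) (y : ι → K) :
    supNorm v (M.mulVec y) ≤ supNorm v y := by
  rw [supNorm_le_iff]
  intro i
  refine v.map_sum_le fun j _ => ?_
  rw [map_mul]
  exact (mul_le_of_le_one_left' (hM i j)).trans (le_supNorm v y j)

theorem supNorm_pow {d : ℕ} (hd : d ≠ 0) (y : ι → K) :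
    supNorm v (fun i => y i ^ d) = supNorm v y ^ d := by
  refine le_antisymm ((supNorm_le_iff v).mpr fun i => ?_) ?_
  · rw [map_pow]
    exact pow_le_pow_left' (le_supNorm v y i) d
  · rcases eq_or_ne (supNorm v y) 0 with h | h
    · simp [h, hd]
    · obtain ⟨i, hi⟩ := exists_eq_supNorm v h
      rw [← hi, ← map_pow]
      exact le_supNorm v (fun i => y i ^ d) i

theorem supNorm_add_eq_left {y z : ι → K} (h : supNorm v z < supNorm v y) :
    supNorm v (fun i => y i + z i) = supNorm v y := by
  refine le_antisymm ((supNorm_le_iff v).mpr fun i => ?_) ?_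
  · exact (v.map_add _ _).trans (max_le (le_supNorm v y i) ((le_supNorm v z i).trans h.le))
  · obtain ⟨i, hi⟩ := exists_eq_supNorm v (zero_le.trans_lt h).ne'
    have := v.map_add_eq_of_lt_left (((le_supNorm v z i).trans_lt h).trans_eq hi.symm)
    rw [← hi, ← this]
    exact le_supNorm v (fun i => y i + z i) i

theorem supNorm_mul_right {c : K} (hc : v c = 1) (y : ι → K) :
    supNorm v (fun i => y i * c) = supNorm v y := by
  simp [supNorm, hc]

end

variable {N d : ℕ}

theorem valuation_adjugate_le_one {ι : Type*} [Fintype ι] [DecidableEq ι]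
    (O : ValuationSubring K) {M : Matrix ι ι K} (hM : ∀ i j, M i j ∈ O) (i j : ι) :
    O.valuation (M.adjugate i j) ≤ 1 := by
  let M' : Matrix ι ι O := Matrix.of fun i j => ⟨M i j, hM i j⟩
  have h : M = O.subtype.mapMatrix M' := rfl
  rw [h, ← RingHom.map_adjugate, O.valuation_le_one_iff]
  exact (M'.adjugate i j).2

/-- Both `A` and its inverse, the adjugate, have integral entries, so neither increases the norm. -/
theorem supNorm_specialLinear_mulVec (O : ValuationSubring K)
    (A : Matrix.SpecialLinearGroup (Fin N) K) (hA : ∀ i j, A.1 i j ∈ O) (y : Fin N → K) :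
    supNorm O.valuation (A.1.mulVec y) = supNorm O.valuation y := by
  refine le_antisymm (supNorm_mulVec_le _ (fun i j => (O.valuation_le_one_iff _).mpr (hA i j)) y) ?_
  calc supNorm O.valuation y
      = supNorm O.valuation (A.1.adjugate.mulVec (A.1.mulVec y)) := by
        rw [Matrix.mulVec_mulVec, Matrix.adjugate_mul, A.2, one_smul, Matrix.one_mulVec]
    _ ≤ _ := supNorm_mulVec_le _ (valuation_adjugate_le_one O hA) _

variable [IsAlgClosed K] (hd : 2 ≤ d) (A : Matrix.SpecialLinearGroup (Fin N) K) (b : Fin N → K)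

/-- The affine coordinates of a vector of homogeneous coordinates. -/
abbrev affinePart (x : Fin N ⊕ Unit → K) : Fin N → K := fun i => x (.inl i)

/-- The term `A x^d` has norm `|x|^d > |x| ≥ |b|` and dominates. -/
theorem supNorm_coordMap_unicritical (O : ValuationSubring K) (hA : ∀ i j, A.1 i j ∈ O)
    (hb : 1 < supNorm O.valuation b) {x : Fin N ⊕ Unit → K} (hx0 : O.valuation (x (.inr ())) = 1)
    (hx : supNorm O.valuation b ≤ supNorm O.valuation (affinePart x)) :
    supNorm O.valuation (affinePart ((unicritical hd A b).coordMap x)) =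
      supNorm O.valuation (affinePart x) ^ d := by
  have h1 : supNorm O.valuation (A.1.mulVec fun j => x (.inl j) ^ d) =
      supNorm O.valuation (affinePart x) ^ d := by
    rw [supNorm_specialLinear_mulVec O A hA, ← supNorm_pow _ (by omega)]
  have h2 : supNorm O.valuation (fun i => b i * x (.inr ()) ^ d) = supNorm O.valuation b :=
    supNorm_mul_right _ (by rw [map_pow, hx0, one_pow]) b
  have h3 : affinePart ((unicritical hd A b).coordMap x) = fun i =>
      A.1.mulVec (fun j => x (.inl j) ^ d) i + b i * x (.inr ()) ^ d :=
    funext fun i => coordMap_unicritical_inl hd A b x i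
  rw [h3, supNorm_add_eq_left, h1]
  rw [h1, h2]
  exact hx.trans_lt (lt_self_pow₀ (hb.trans_le hx) (by omega))

theorem supNorm_iterate_coordMap_unicritical (O : ValuationSubring K) (hA : ∀ i j, A.1 i j ∈ O)
    (hb : 1 < supNorm O.valuation b) {x : Fin N ⊕ Unit → K} (hx0 : O.valuation (x (.inr ())) = 1)
    (hx : supNorm O.valuation b ≤ supNorm O.valuation (affinePart x)) (n : ℕ) :
    supNorm O.valuation (affinePart ((unicritical hd A b).coordMap^[n] x)) =
      supNorm O.valuation (affinePart x) ^ d ^ n := by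
  induction n generalizing x with
  | zero => simp
  | succ n ih =>
    have h := supNorm_coordMap_unicritical hd A b O hA hb hx0 hx
    rw [Function.iterate_succ_apply, ih, h, ← pow_mul, pow_succ']
    · rw [coordMap_unicritical_inr, map_pow, hx0, one_pow]
    · rw [h]
      exact hx.trans (le_self_pow₀ (hb.le.trans hx) (by omega))

/-- A unicritical map whose linear part is integral at some place and whose constant part is not
is not post-critically finite: some critical hyperplane escapes to infinity. -/
theorem not_isPCF_of_notMem_valuationSubring (O : ValuationSubring K) (hA : ∀ i j, A.1 i j ∈ O)
    {l : Fin N} (hb : b l ∉ O) : ¬ (unicritical hd A b).IsPCF := by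
  intro h
  have hd0 : d ≠ 0 := by omega
  have hB : 1 < supNorm O.valuation b :=
    (not_le.mp fun hle => hb ((O.valuation_le_one_iff _).mp hle)).trans_le
      (le_supNorm O.valuation b l)
  set B := supNorm O.valuation b with hBdef
  have hc : supNorm O.valuation (A.1.adjugate.mulVec b) = B := by
    rw [← supNorm_specialLinear_mulVec O A hA, Matrix.mulVec_mulVec, Matrix.mul_adjugate, A.2,
      one_smul, Matrix.one_mulVec]
  obtain ⟨j, hj⟩ := exists_eq_supNorm O.valuation
    (y := A.1.adjugate.mulVec b) (by rw [hc]; exact (zero_lt_one.trans hB).ne')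
  rw [hc] at hj
  obtain ⟨m, n, hm, hmn, x, hxj, hxm⟩ := exists_iterate_eq_of_isPCF hd A b h j
  -- The lift `x` need not have last coordinate `1`, but that coordinate is a root of unity.
  have hx0 : O.valuation (x (.inr ())) = 1 := by
    have h1 := congrFun hxm (.inr ())
    rw [iterate_coordMap_unicritical_inr, iterate_coordMap_unicritical_inr, Pi.single_eq_same,
      one_pow] at h1
    have h2 := congrArg O.valuation h1
    rw [map_pow, map_one] at h2
    exact (pow_eq_one_iff.mp h2).resolve_right (pow_ne_zero n hd0)
  have hfirst : B ≤ supNorm O.valuation (affinePart ((unicritical hd A b).coordMap x)) := by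
    have h3 : affinePart ((unicritical hd A b).coordMap x) =
        A.1.mulVec (fun j => x (.inl j) ^ d) + x (.inr ()) ^ d • b :=
      funext fun i => by
        simp [affinePart, coordMap_unicritical_inl, mul_comm (b i)]
    have h4 : A.1.adjugate.mulVec (affinePart ((unicritical hd A b).coordMap x)) j =
        x (.inr ()) ^ d * A.1.adjugate.mulVec b j := by
      rw [h3, Matrix.mulVec_add, Matrix.mulVec_mulVec, Matrix.adjugate_mul, A.2, one_smul,
        Matrix.one_mulVec, Matrix.mulVec_smul]
      simp [hxj, hd0]
    calc B = O.valuation (A.1.adjugate.mulVec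
          (affinePart ((unicritical hd A b).coordMap x)) j) := by
          rw [h4, map_mul, map_pow, hx0, hj, one_pow, one_mul]
      _ ≤ _ := le_supNorm _ _ j
      _ ≤ _ := supNorm_mulVec_le _ (valuation_adjugate_le_one O hA) _
  have horigin : affinePart ((unicritical hd A b).coordMap (Pi.single (.inr ()) 1)) = b :=
    funext fun i => by
      simp [affinePart, coordMap_unicritical_inl, hd0, Matrix.mulVec, dotProduct]
  -- One iteration is split off: growth is guaranteed only from the first image on.
  obtain ⟨m, rfl⟩ := Nat.exists_eq_add_of_le' hm
  obtain ⟨n, rfl⟩ := Nat.exists_eq_add_of_le' (hm.trans hmn.le)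
  have hnorm := congrArg (fun z => supNorm O.valuation (affinePart z)) hxm
  simp only [Function.iterate_succ_apply] at hnorm
  rw [supNorm_iterate_coordMap_unicritical hd A b O hA hB
      (by rw [coordMap_unicritical_inr, map_pow, hx0, one_pow]) hfirst,
    supNorm_iterate_coordMap_unicritical hd A b O hA hB
      (by rw [coordMap_unicritical_inr, Pi.single_eq_same, one_pow, map_one])
      (by rw [horigin]), horigin, ← hBdef] at hnorm
  refine absurd hnorm (ne_of_gt ?_)
  calc B ^ d ^ m < B ^ d ^ n :=
        pow_lt_pow_right₀ hB (Nat.pow_lt_pow_right (by omega) (by omega))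
    _ ≤ _ := pow_le_pow_left' hfirst _

end Valuation

/-! ### Generic members and members at rational points -/

section Families

theorem Family.exists_ne_const {k : Type u} [Field k] {N : ℕ} {V : Scheme.{u}}
    {π : V ⟶ Spec (.of k)} {f : Family V N} (hb : ¬ f.ConstantB π) :
    ∃ i, ∀ c, f.b i ≠ const π c := by
  contrapose! hb
  choose b₀ hb₀ using hb
  exact ⟨b₀, hb₀⟩

variable {k : Type u} [Field k] [IsAlgClosed k] {N d : ℕ} {V : Scheme.{u}} {π : V ⟶ Spec (.of k)}

theorem Family.genericMember_not_isPCF [IsIntegral V] (hd : 2 ≤ d) (f : Family V N)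
    (hA : f.ConstantA π) (hb : ¬ f.ConstantB π) : ¬ (f.genericMember hd).IsPCF := by
  obtain ⟨A₀, hA₀⟩ := hA
  obtain ⟨i, hi⟩ := f.exists_ne_const hb
  set ψ : Γ(V, ⊤) →+* AlgebraicClosure V.functionField :=
    (algebraMap V.functionField (AlgebraicClosure V.functionField)).comp
      (V.presheaf.germ ⊤ (genericPoint V) trivial).hom with hψ
  have hψinj : Function.Injective ψ :=
    (algebraMap V.functionField (AlgebraicClosure V.functionField)).injective.comp
      (germ_injective_of_isIntegral V (U := ⊤) (genericPoint V) trivial)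
  algebraize [ψ.comp (const π)]
  have hint : ¬ IsIntegral k (ψ (f.b i)) := by
    intro h
    obtain ⟨c, hc⟩ := exists_algebraMap_eq_of_isIntegral h
    exact hi c (hψinj hc.symm)
  obtain ⟨O, hO, hbO⟩ := exists_valuationSubring_of_not_isIntegral hint
  refine not_isPCF_of_notMem_valuationSubring hd _ _ O (fun l m => ?_) hbO
  rw [hA₀]
  exact hO (A₀.1 l m)

/-- A non-constant regular function on a variety over an algebraically closed field takes all but
finitely many values at the rational points. -/
theorem exists_point_apply_eq [IsIntegral V] [LocallyOfFiniteType π] {s : Γ(V, ⊤)}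
    (hs : ∀ c, s ≠ const π c) :
    ∃ h : Polynomial k, h ≠ 0 ∧ ∀ β : k, h.eval β ≠ 0 → ∃ t : Spec (.of k) ⟶ V, t ≫ π = 𝟙 _ ∧
      (t.appTop ≫ (Scheme.ΓSpecIso (.of k)).hom).hom s = β := by
  -- By integrality, restriction to a nonempty affine open set is injective, so `s` stays
  -- transcendental over `k` there.
  obtain ⟨U, hU, hxU, -⟩ := exists_isAffineOpen_mem_and_subset
    (X := V) (U := ⊤) (x := genericPoint V) trivial
  have : Nonempty U := ⟨⟨_, hxU⟩⟩
  let res : Γ(V, ⊤) →+* Γ(V, U) := (V.presheaf.map (homOfLE le_top : U ⟶ ⊤).op).hom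
  have hres : Function.Injective res := map_injective_of_isIntegral V (homOfLE le_top : U ⟶ ⊤)
  have hft : (res.comp (const π)).FiniteType := by
    have h1 : (π.appLE ⊤ U le_top).hom.FiniteType :=
      π.finiteType_appLE (isAffineOpen_top _) hU _
    have h2 : res.comp (const π) =
        (π.appLE ⊤ U le_top).hom.comp (Scheme.ΓSpecIso (.of k)).inv.hom := rfl
    rw [h2]
    exact h1.comp (.of_surjective _
      (Scheme.ΓSpecIso (.of k)).commRingCatIsoToRingEquiv.symm.surjective)
  algebraize [res.comp (const π)]
  have htr : Transcendental k (res s) := by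
    intro h
    obtain ⟨c, hc⟩ := exists_algebraMap_eq_of_isIntegral h.isIntegral
    exact hs c (hres hc.symm)
  obtain ⟨h, h0, hh⟩ := exists_algHom_apply_eq htr
  refine ⟨h, h0, fun β hβ => ?_⟩
  obtain ⟨σ, hσ⟩ := hh β hβ
  let σ' : Γ(V, U) ⟶ CommRingCat.of k := CommRingCat.ofHom σ.toRingHom
  have happ : (Spec.map σ' ≫ hU.fromSpec).appTop ≫ (Scheme.ΓSpecIso (.of k)).hom =
      V.presheaf.map (homOfLE le_top : U ⟶ ⊤).op ≫ σ' := by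
    have hid : (Scheme.ΓSpecIso Γ(V, U)).inv ≫ (Spec Γ(V, U)).presheaf.map
        (homOfLE (le_top : (⊤ : (Spec Γ(V, U)).Opens) ≤ ⊤)).op =
          (Scheme.ΓSpecIso Γ(V, U)).inv := by
      rw [show (homOfLE (le_top : (⊤ : (Spec Γ(V, U)).Opens) ≤ ⊤)).op = 𝟙 _ from rfl,
        CategoryTheory.Functor.map_id, Category.comp_id]
    have hfrom : hU.fromSpec.appTop = V.presheaf.map (homOfLE le_top : U ⟶ ⊤).op ≫
        (Scheme.ΓSpecIso Γ(V, U)).inv :=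
      (hU.fromSpec_app_of_le ⊤ le_top).trans (congrArg (_ ≫ ·) hid)
    rw [Scheme.Hom.comp_appTop, Category.assoc, Scheme.ΓSpecIso_naturality, hfrom,
      Category.assoc, Iso.inv_hom_id_assoc]
  refine ⟨Spec.map σ' ≫ hU.fromSpec, ?_, ?_⟩
  · refine ext_of_isAffine ?_
    rw [← cancel_epi (Scheme.ΓSpecIso (.of k)).inv, ← cancel_mono (Scheme.ΓSpecIso (.of k)).hom]
    rw [Scheme.Hom.comp_appTop, Category.assoc, Category.assoc, happ]
    ext c
    simp only [Category.assoc, Scheme.Hom.id_appTop, Category.id_comp, Iso.inv_hom_id]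
    exact σ.commutes c
  · rw [happ]
    exact hσ

theorem Family.exists_member_not_isPCF [IsIntegral V] [LocallyOfFiniteType π] (hd : 2 ≤ d)
    (hk : ∀ (p : ℕ) [Fact p.Prime] [Algebra (ZMod p) k], ¬ Algebra.IsAlgebraic (ZMod p) k)
    (f : Family V N) (hA : f.ConstantA π) (hb : ¬ f.ConstantB π) :
    ∃ t : Spec (.of k) ⟶ V, t ≫ π = 𝟙 _ ∧ ¬ (f.member hd t).IsPCF := by
  obtain ⟨A₀, hA₀⟩ := hA
  obtain ⟨i, hi⟩ := f.exists_ne_const hb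
  obtain ⟨h, h0, hh⟩ := exists_point_apply_eq hi
  have := IsAlgClosed.instInfinite (K := k)
  have hinf := infinite_setOf_not_isIntegral
    (exists_not_isIntegral_adjoin hk (Set.finite_range fun x : Fin N × Fin N => A₀.1 x.1 x.2))
  obtain ⟨β, hβ, hβh⟩ := (hinf.sdiff (h.rootSet_finite k)).nonempty
  obtain ⟨t, ht, htβ⟩ := hh β (fun h1 => hβh (by
    rw [Polynomial.mem_rootSet]
    exact ⟨h0, by simpa using h1⟩))
  refine ⟨t, ht, ?_⟩
  obtain ⟨O, hO, hbO⟩ := exists_valuationSubring_of_not_isIntegral hβ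
  refine not_isPCF_of_notMem_valuationSubring hd _ _ O (fun l m => ?_) (l := i) (by rwa [htβ])
  have hconst (c : k) : (t.appTop ≫ (Scheme.ΓSpecIso (.of k)).hom).hom (const π c) = c := by
    have h1 : (Scheme.ΓSpecIso (.of k)).inv ≫ (t ≫ π).appTop ≫ (Scheme.ΓSpecIso (.of k)).hom =
        𝟙 (CommRingCat.of k) := by
      rw [ht]
      simp
    exact congrArg (fun g : CommRingCat.of k ⟶ CommRingCat.of k => g.hom c) h1
  rw [hA₀]
  change (t.appTop ≫ (Scheme.ΓSpecIso (.of k)).hom).hom (const π (A₀.1 l m)) ∈ O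
  rw [hconst]
  exact hO ⟨A₀.1 l m, Algebra.subset_adjoin ⟨(l, m), rfl⟩⟩

end Families

end PCF

theorem mainTheorem6 {k : Type u} [Field k] [IsAlgClosed k] (N d : ℕ) (hd : 2 ≤ d)
    (hchar : ringChar k = 0 ∨ d < ringChar k)
    {V : Scheme.{u}} (π : V ⟶ Spec (.of k)) [IsIntegral V] [IsSeparated π]
    [LocallyOfFiniteType π] [QuasiCompact π] :
    (¬ ∃ f : PCF.Family V N, (f.genericMember hd).IsPCF ∧ f.ConstantA π ∧ ¬ f.ConstantB π) ∧
    ((∀ (p : ℕ) [Fact p.Prime] [Algebra (ZMod p) k], ¬ Algebra.IsAlgebraic (ZMod p) k) →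
      ¬ ∃ f : PCF.Family V N,
        (∀ t : Spec (.of k) ⟶ V, t ≫ π = 𝟙 _ → (f.member hd t).IsPCF) ∧
          f.ConstantA π ∧ ¬ f.ConstantB π) := by
  refine ⟨?_, fun hk => ?_⟩
  · rintro ⟨f, hf, hA, hb⟩
    exact f.genericMember_not_isPCF hd hA hb hf
  · rintro ⟨f, hf, hA, hb⟩
    obtain ⟨t, ht, hnot⟩ := f.exists_member_not_isPCF hd hk hA hb
    exact hnot (hf t ht)
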